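/- Let $X$ be a compact Kähler manifold of complex dimension $n$ with Kähler form $\omega$, and let $E$ be a holomorphic vector bundle of rank $r$ on $X$. For a Hermitian metric $h$ on $E$, written as a matrix in a local holomorphic frame, let $F_h=\overline{\partial}(h^{-1}\partial h)$ be the curvature of its Chern connection, and let $\Lambda$ be the adjoint of $\alpha\mapsto\omega\wedge\alpha$. Fix a constant $\lambda\in\mathbb{C}$; any constant is allowed, in particular the usual normalization $\lambda=-\frac{2n\pi\deg(E)}{\mathrm{rk}(E)\int_X\omega^n}\,i$. A solution of the Donaldson flow for $t\ge 0$ is a family $(h_t)_{t\geq 0}$ of Hermitian metrics on $E$, smooth on $[0,\infty)\times X$, with $$h_t^{-1}\partial_t h_t=-2i\,(\Lambda F_{h_t}-\lambda)\qquad\text{for all } t\ge 0 .$$ Let $(g_t)_{t\ge0}$ and $(h_t)_{t\ge0}$ be any two solutions of the Donaldson flow on $E$ with the same $\lambda$. Then there is a constant $C\geq 1$ such that for all $t\geq 0$ $$\frac1C\,g_t\leq h_t\leq C\,g_t ,$$ that is, $C^{-1}g_t(v,v)\le h_t(v,v)\le C\,g_t(v,v)$ for all $x\in X$ and all $v\in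 E_x$. -/

import Mathlib

open scoped ContDiff Manifold ComplexConjugate
open Bundle

/-- The model space `ℂⁿ` of an `n`-dimensional complex manifold. -/
abbrev CSpace (n : ℕ) : Type := EuclideanSpace ℂ (Fin n)

/-- The `j`-th standard basis vector of `ℂⁿ`. -/
noncomputable def stdVec {n : ℕ} (j : Fin n) : CSpace n := EuclideanSpace.single j 1

/-- The Wirtinger derivative `∂f/∂z_j = ½ (∂f/∂x_j - i ∂f/∂y_j)` of a function on `ℂⁿ`. -/
noncomputable def dZ {n : ℕ} (j : Fin n) (f : CSpace n → ℂ) (z : CSpace n) : ℂ :=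
  (1 / 2) * (fderiv ℝ f z (stdVec j) - Complex.I * fderiv ℝ f z (Complex.I • stdVec j))

/-- The Wirtinger derivative `∂f/∂z̄_j = ½ (∂f/∂x_j + i ∂f/∂y_j)` of a function on `ℂⁿ`. -/
noncomputable def dZbar {n : ℕ} (j : Fin n) (f : CSpace n → ℂ) (z : CSpace n) : ℂ :=
  (1 / 2) * (fderiv ℝ f z (stdVec j) + Complex.I * fderiv ℝ f z (Complex.I • stdVec j))

/-- Entrywise `∂/∂z_j` of a matrix-valued function. -/
noncomputable def matDZ {n r : ℕ} (j : Fin n) (A : CSpace n → Matrix (Fin r) (Fin r) ℂ)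
    (z : CSpace n) : Matrix (Fin r) (Fin r) ℂ :=
  Matrix.of fun a b => dZ j (fun w => A w a b) z

/-- Entrywise `∂/∂z̄_j` of a matrix-valued function. -/
noncomputable def matDZbar {n r : ℕ} (j : Fin n) (A : CSpace n → Matrix (Fin r) (Fin r) ℂ)
    (z : CSpace n) : Matrix (Fin r) (Fin r) ℂ :=
  Matrix.of fun a b => dZbar j (fun w => A w a b) z

/-! ### Kähler forms -/

/-- A field of real 2-forms on a complex manifold. -/
abbrev TwoFormField (n : ℕ) (X : Type*) [TopologicalSpace X] [ChartedSpace (CSpace n) X] :=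
  ∀ x : X, TangentSpace 𝓘(ℂ, CSpace n) x [⋀^Fin 2]→L[ℝ] ℝ

/-- The expression of a field of 2-forms in the chart `φ`, i.e. its pullback by `φ⁻¹`. -/
noncomputable def TwoFormField.inChart {n : ℕ} {X : Type*} [TopologicalSpace X]
    [ChartedSpace (CSpace n) X] (α : TwoFormField n X) (φ : OpenPartialHomeomorph X (CSpace n))
    (z : CSpace n) : CSpace n [⋀^Fin 2]→L[ℝ] ℝ :=
  (α (φ.symm z)).compContinuousLinearMap
    ((mfderiv 𝓘(ℂ, CSpace n) 𝓘(ℂ, CSpace n) φ.symm z).restrictScalars ℝ)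

/-- A Kähler form on a complex manifold: a smooth closed real 2-form of type `(1,1)`
which is positive. The complex structure on tangent vectors is multiplication by `i`. -/
structure KaehlerForm (n : ℕ) (X : Type*) [TopologicalSpace X] [ChartedSpace (CSpace n) X] where
  /-- the underlying field of 2-forms -/
  form : TwoFormField n X
  smooth : ∀ φ ∈ atlas (CSpace n) X, ContDiffOn ℝ ∞ (form.inChart φ) φ.target
  closed : ∀ φ ∈ atlas (CSpace n) X, ∀ z ∈ φ.target, extDeriv (form.inChart φ) z = 0
  type_one_one : ∀ (x : X) (u v : TangentSpace 𝓘(ℂ, CSpace n) x),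
    form x ![Complex.I • u, Complex.I • v] = form x ![u, v]
  pos : ∀ (x : X) (v : TangentSpace 𝓘(ℂ, CSpace n) x), v ≠ 0 → 0 < form x ![v, Complex.I • v]

/-- The matrix `(g_{j k̄})` of the Kähler form `ω = i ∑ g_{j k̄} dz_j ∧ dz̄_k` in the chart `φ`,
that is `g_{j k̄} = ½ (ω(e_j, i e_k) - i ω(e_j, e_k))`. -/
noncomputable def KaehlerForm.gram {n : ℕ} {X : Type*} [TopologicalSpace X]
    [ChartedSpace (CSpace n) X] (Ω : KaehlerForm n X)
    (φ : OpenPartialHomeomorph X (CSpace n)) (z : CSpace n) : Matrix (Fin n) (Fin n) ℂ :=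
  Matrix.of fun j k =>
    (1 / 2) * ((Ω.form.inChart φ z ![stdVec j, Complex.I • stdVec k] : ℂ) -
      Complex.I * (Ω.form.inChart φ z ![stdVec j, stdVec k] : ℂ))

/-- The operator `Λ` (the adjoint of `L f = f ω`, so `Λ α = ⟨α, ω⟩`) on a matrix-valued
`(1,1)`-form `∑ a_{j k̄} dz_j ∧ dz̄_k` at a point where `ω` has matrix `G = (g_{j k̄})`:
`Λ a = -i ∑ (G⁻¹)_{k j} a_{j k̄}`. In particular `Λ ω = n`. -/
noncomputable def lambdaOp {n r : ℕ} (G : Matrix (Fin n) (Fin n) ℂ)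
    (a : Fin n → Fin n → Matrix (Fin r) (Fin r) ℂ) : Matrix (Fin r) (Fin r) ℂ :=
  (-Complex.I) • ∑ j, ∑ k, (G⁻¹ k j) • a j k

/-! ### Hermitian metrics on a holomorphic vector bundle -/

section Bundle

variable {n r : ℕ} {X : Type*} [TopologicalSpace X] [ChartedSpace (CSpace n) X]
  {E : X → Type*} [∀ x, AddCommGroup (E x)] [∀ x, Module ℂ (E x)] [∀ x, TopologicalSpace (E x)]
  [TopologicalSpace (TotalSpace (Fin r → ℂ) E)] [FiberBundle (Fin r → ℂ) E]
  [VectorBundle ℂ (Fin r → ℂ) E]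

/-- The `a`-th vector at `x` of the local holomorphic frame given by a local trivialization. -/
noncomputable def frameVec (e : Trivialization (Fin r → ℂ) (π (Fin r → ℂ) E)) (x : X)
    (a : Fin r) : E x :=
  e.symm x (Pi.single a 1)

variable (n r E) in
/-- A smooth Hermitian metric on the complex vector bundle `E` of rank `r`; it is conjugate-linear
in the first and linear in the second variable. -/
structure HermitianMetric where
  /-- the Hermitian form on the fibre `E x` -/
  inner : ∀ x : X, E x →ₗ⋆[ℂ] E x →ₗ[ℂ] ℂ
  conj_symm : ∀ (x : X) (v w : E x), conj (inner x v w) = inner x w v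
  pos : ∀ (x : X) (v : E x), v ≠ 0 → 0 < (inner x v v).re
  smooth : ∀ (e : Trivialization (Fin r → ℂ) (π (Fin r → ℂ) E)) [MemTrivializationAtlas e]
    (a b : Fin r), ContMDiffOn 𝓘(ℝ, CSpace n) 𝓘(ℝ, ℂ) ∞
      (fun x => inner x (frameVec e x a) (frameVec e x b)) e.baseSet

/-- The (real) number `h(v, v)`. -/
def HermitianMetric.sq (h : HermitianMetric n r E) (x : X) (v : E x) : ℝ := (h.inner x v v).re

/-- The matrix `h_{ab} = h(s_a, s_b)` of `h` in the local holomorphic frame `s` given by `e`, as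
a function on the chart `φ`. -/
noncomputable def HermitianMetric.mat (h : HermitianMetric n r E)
    (φ : OpenPartialHomeomorph X (CSpace n))
    (e : Trivialization (Fin r → ℂ) (π (Fin r → ℂ) E)) (z : CSpace n) :
    Matrix (Fin r) (Fin r) ℂ :=
  Matrix.of fun a b =>
    h.inner (φ.symm z) (frameVec e (φ.symm z) a) (frameVec e (φ.symm z) b)

/-- The coefficients `F_{j k̄}` of the curvature `F = ∂̄(h⁻¹ ∂h) = ∑ F_{j k̄} dz_j ∧ dz̄_k` of the
Chern connection `d + h⁻¹ ∂h` of `h`, in a chart and a local holomorphic frame: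
`F_{j k̄} = - ∂/∂z̄_k (h⁻¹ ∂h/∂z_j)`. -/
noncomputable def HermitianMetric.curvature (h : HermitianMetric n r E)
    (φ : OpenPartialHomeomorph X (CSpace n))
    (e : Trivialization (Fin r → ℂ) (π (Fin r → ℂ) E)) (z : CSpace n) (j k : Fin n) :
    Matrix (Fin r) (Fin r) ℂ :=
  - matDZbar k (fun w => (h.mat φ e w)⁻¹ * matDZ j (h.mat φ e) w) z

/-- `h_t`, `t ≥ 0`, is a solution of the Donaldson flow `h⁻¹ ∂_t h = -2i (Λ F - lam)`:
the family is smooth on `[0, ∞) × X`, and the equation holds in every chart and every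
local holomorphic frame. Only the values `h t` for `t ≥ 0` matter. -/
structure IsDonaldsonFlow (Ω : KaehlerForm n X) (lam : ℂ) (h : ℝ → HermitianMetric n r E) :
    Prop where
  smooth : ∀ (e : Trivialization (Fin r → ℂ) (π (Fin r → ℂ) E)) [MemTrivializationAtlas e]
    (a b : Fin r), ContMDiffOn (𝓘(ℝ, ℝ).prod 𝓘(ℝ, CSpace n)) 𝓘(ℝ, ℂ) ∞
      (fun p : ℝ × X => (h p.1).inner p.2 (frameVec e p.2 a) (frameVec e p.2 b))
      (Set.Ici 0 ×ˢ e.baseSet)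
  flow : ∀ (e : Trivialization (Fin r → ℂ) (π (Fin r → ℂ) E)) [MemTrivializationAtlas e],
    ∀ φ ∈ atlas (CSpace n) X, ∀ z ∈ φ.target, φ.symm z ∈ e.baseSet → ∀ t : ℝ, 0 ≤ t →
      ((h t).mat φ e z)⁻¹ *
          (Matrix.of fun a b => derivWithin (fun s => (h s).mat φ e z a b) (Set.Ici 0) t) =
        (-2 * Complex.I) •
          (lambdaOp (Ω.gram φ z) ((h t).curvature φ e z) -
            lam • (1 : Matrix (Fin r) (Fin r) ℂ))

end Bundle

/-! Let σ = tr(g⁻¹h), a function on [0,∞) × X. It suffices to bound σ from above. Indeed h ≤ σ g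
pointwise, because the Frobenius norm dominates the operator norm
(`Matrix.PosDef.re_form_le_trace_mul`), and exchanging g and h gives the other inequality.

The bound on σ is a maximum principle argument. One has ∂_tσ = tr(g⁻¹h(h⁻¹∂_t h − g⁻¹∂_t g)). In the
difference of the two flow equations λ cancels, and what remains is twice the contraction with the
inverse Kähler matrix of tr(g⁻¹h(∂_k̄(h⁻¹∂_j h) − ∂_k̄(g⁻¹∂_j g))). By `trace_curvature_difference`
this trace equals ∂_k̄∂_jσ minus tr(g⁻¹B_k* h⁻¹B_j), where B_j = h(h⁻¹∂_j h − g⁻¹∂_j g), and the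
contraction of the second term is nonnegative. So σ is a subsolution of a heat equation.

At a spatial maximum of σ the contracted complex Hessian is nonpositive, hence ∂_tσ ≤ 0 there. As X
is compact, `exists_bound_of_deriv_nonpos_at_max` bounds σ by the maximum of σ(0,·). -/

/-! ### Positive matrices and the trace of g⁻¹h -/

section LinearAlgebra

open scoped MatrixOrder ComplexOrder

theorem Matrix.PosSemidef.exists_eq_conjTranspose_mul {m : ℕ} {A : Matrix (Fin m) (Fin m) ℂ}
    (hA : A.PosSemidef) : ∃ C : Matrix (Fin m) (Fin m) ℂ, A = C.conjTranspose * C := by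
  obtain ⟨B, rfl⟩ := CStarAlgebra.nonneg_iff_eq_star_mul_self.mp hA.nonneg
  exact ⟨B, rfl⟩

theorem Matrix.PosSemidef.re_trace_mul_conj_nonneg {m : ℕ} {P Q : Matrix (Fin m) (Fin m) ℂ}
    (hP : P.PosSemidef) (hQ : Q.PosSemidef) (D : Matrix (Fin m) (Fin m) ℂ) :
    0 ≤ (P * D.conjTranspose * Q * D).trace.re := by
  obtain ⟨Y, rfl⟩ := hP.exists_eq_conjTranspose_mul
  have h := (hQ.conjTranspose_mul_mul_same (D * Y.conjTranspose)).trace_nonneg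
  have e : (Y.conjTranspose * Y * D.conjTranspose * Q * D).trace =
      ((D * Y.conjTranspose).conjTranspose * Q * (D * Y.conjTranspose)).trace := by
    rw [Matrix.conjTranspose_mul, Matrix.conjTranspose_conjTranspose]
    simp only [Matrix.mul_assoc]
    rw [Matrix.trace_mul_comm]
    simp only [Matrix.mul_assoc]
  rw [e]
  exact (Complex.le_def.1 h).1

/-- Cauchy–Schwarz for the Frobenius norm. -/
theorem Matrix.re_dotProduct_le_trace_mul {m : ℕ} (C : Matrix (Fin m) (Fin m) ℂ)
    (w : Fin m → ℂ) :
    (star (C.mulVec w) ⬝ᵥ C.mulVec w).re ≤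
      (C.conjTranspose * C).trace.re * (star w ⬝ᵥ w).re := by
  have n1 : ∀ u : Fin m → ℂ, (star u ⬝ᵥ u).re = ∑ a, ‖u a‖ ^ 2 := by
    intro u
    simp [dotProduct, Complex.sq_norm, Complex.normSq_apply]
  have n2 : (C.conjTranspose * C).trace.re = ∑ a, ∑ b, ‖C a b‖ ^ 2 := by
    rw [Finset.sum_comm]
    simp [Matrix.trace, Matrix.mul_apply, Complex.sq_norm, Complex.normSq_apply]
  rw [n1, n1, n2, Finset.sum_mul]
  refine Finset.sum_le_sum fun a _ => ?_
  calc ‖C.mulVec w a‖ ^ 2 ≤ (∑ b, ‖C a b‖ * ‖w b‖) ^ 2 := by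
        gcongr
        calc ‖C.mulVec w a‖ = ‖∑ b, C a b * w b‖ := rfl
          _ ≤ ∑ b, ‖C a b * w b‖ := norm_sum_le _ _
          _ = _ := by simp only [norm_mul]
    _ ≤ _ := Finset.sum_mul_sq_le_sq_mul_sq _ _ _

/-- Write G = B*B and H = C*C. Then |Cv|² = |(CB⁻¹)(Bv)|² is at most the squared Frobenius norm of
CB⁻¹ times |Bv|², and that squared norm is tr(G⁻¹H) by cyclicity. -/
theorem Matrix.PosDef.re_form_le_trace_mul {m : ℕ} {G H : Matrix (Fin m) (Fin m) ℂ}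
    (hG : G.PosDef) (hH : H.PosSemidef) (v : Fin m → ℂ) :
    (star v ⬝ᵥ H.mulVec v).re ≤ (G⁻¹ * H).trace.re * (star v ⬝ᵥ G.mulVec v).re := by
  obtain ⟨B, hB⟩ := hG.posSemidef.exists_eq_conjTranspose_mul
  have hdet : IsUnit B.det := by
    have := (Matrix.isUnit_iff_isUnit_det _).1 hG.isUnit
    rw [hB, Matrix.det_mul] at this
    exact isUnit_of_mul_isUnit_right this
  obtain ⟨C, hC⟩ := hH.exists_eq_conjTranspose_mul
  have key := Matrix.re_dotProduct_le_trace_mul (C * B⁻¹) (B.mulVec v)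
  have e1 : (C * B⁻¹).mulVec (B.mulVec v) = C.mulVec v := by
    rw [Matrix.mulVec_mulVec, Matrix.mul_assoc, Matrix.nonsing_inv_mul _ hdet, Matrix.mul_one]
  have e2 : ((C * B⁻¹).conjTranspose * (C * B⁻¹)).trace = (G⁻¹ * H).trace := by
    rw [hB, hC, Matrix.mul_inv_rev, Matrix.conjTranspose_mul, Matrix.conjTranspose_nonsing_inv,
      Matrix.mul_assoc B⁻¹, Matrix.trace_mul_comm B⁻¹]
    simp only [Matrix.mul_assoc]
  have e3 : ∀ A : Matrix (Fin m) (Fin m) ℂ,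
      star v ⬝ᵥ (A.conjTranspose * A).mulVec v = star (A.mulVec v) ⬝ᵥ A.mulVec v := by
    intro A
    rw [← Matrix.mulVec_mulVec, Matrix.dotProduct_mulVec, Matrix.star_mulVec]
  rw [e1, e2] at key
  rw [hB, hC, e3, e3, ← hB, ← hC]
  exact key

/-- The algebraic identity behind the heat inequality for `tr (g⁻¹ h)`. -/
theorem Matrix.trace_heat_identity {m : ℕ}
    {h p q gj gk gkj hj hk hkj : Matrix (Fin m) (Fin m) ℂ} (hq : h * q = 1) :
    (p * h * ((-(q * hk * q) * hj + q * hkj) - (-(p * gk * p) * gj + p * gkj))).trace =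
      ((-(p * gk * p)) * (hj - gj * p * h) +
        p * (hkj - (gkj * p * h + gj * (-(p * gk * p)) * h + gj * p * hk))).trace -
      (p * (hk - gk * p * h) * q * (hj - h * p * gj)).trace := by
  -- Here p, q stand for g⁻¹, h⁻¹, and the indices j, k for ∂_j, ∂_k̄. After expansion the two sides
  -- differ only by these four cyclic rotations under the trace.
  have c1 : (p * gk * p * gj * p * h).trace = (p * h * p * gk * p * gj).trace := by
    rw [show p * gk * p * gj * p * h = (p * gk * p * gj) * (p * h) by simp only [mul_assoc],
      Matrix.trace_mul_comm]; simp only [mul_assoc]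
  have c2 : (p * gj * p * gk * p * h).trace = (p * gk * p * h * p * gj).trace := by
    rw [show p * gj * p * gk * p * h = (p * gj) * (p * gk * p * h) by simp only [mul_assoc],
      Matrix.trace_mul_comm]; simp only [mul_assoc]
  have c3 : (p * gj * p * hk).trace = (p * hk * p * gj).trace := by
    rw [show p * gj * p * hk = (p * gj) * (p * hk) by simp only [mul_assoc],
      Matrix.trace_mul_comm]; simp only [mul_assoc]
  have c4 : (p * gkj * p * h).trace = (p * h * p * gkj).trace := by
    rw [show p * gkj * p * h = (p * gkj) * (p * h) by simp only [mul_assoc],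
      Matrix.trace_mul_comm]; simp only [mul_assoc]
  have hq' : ∀ A : Matrix (Fin m) (Fin m) ℂ, h * (q * A) = A := fun A => by
    rw [← mul_assoc, hq, one_mul]
  have hq2 : q * h = 1 := mul_eq_one_comm.1 hq
  have hq3 : ∀ A : Matrix (Fin m) (Fin m) ℂ, q * (h * A) = A := fun A => by
    rw [← mul_assoc, hq2, one_mul]
  simp only [mul_assoc] at c1 c2 c3 c4
  simp only [mul_sub, sub_mul, mul_add, neg_mul, mul_neg, mul_assoc, hq', hq3,
    Matrix.trace_sub, Matrix.trace_add, Matrix.trace_neg]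
  linear_combination (-1 : ℂ) * c1 + (-1 : ℂ) * c2 + c3 + c4

end LinearAlgebra

/-! ### Entrywise calculus of matrix-valued functions -/

section EntrywiseCalculus

variable {V : Type*} [NormedAddCommGroup V] [NormedSpace ℝ V] {m : ℕ}

/-- Entrywise differentiability of a matrix-valued function. -/
def EntryDiffAt (A : V → Matrix (Fin m) (Fin m) ℂ) (z : V) : Prop :=
  ∀ a b, DifferentiableAt ℝ (fun w => A w a b) z

/-- Entrywise smoothness of a matrix-valued function. -/
def EntrySmoothAt (A : V → Matrix (Fin m) (Fin m) ℂ) (z : V) : Prop :=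
  ∀ a b, ContDiffAt ℝ ∞ (fun w => A w a b) z

/-- The entrywise first order operator `L ∘ d` on matrix-valued functions. -/
noncomputable def matDeriv (L : (V →L[ℝ] ℂ) →ₗ[ℂ] ℂ) (A : V → Matrix (Fin m) (Fin m) ℂ)
    (z : V) : Matrix (Fin m) (Fin m) ℂ :=
  Matrix.of fun a b => L (fderiv ℝ (fun w => A w a b) z)

variable {A B : V → Matrix (Fin m) (Fin m) ℂ} {z : V} {L : (V →L[ℝ] ℂ) →ₗ[ℂ] ℂ}

theorem EntrySmoothAt.entryDiffAt (hA : EntrySmoothAt A z) : EntryDiffAt A z :=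
  fun a b => (hA a b).differentiableAt (by simp)

theorem EntryDiffAt.mul (hA : EntryDiffAt A z) (hB : EntryDiffAt B z) :
    EntryDiffAt (fun w => A w * B w) z := by
  intro a b
  simp only [Matrix.mul_apply]
  exact DifferentiableAt.fun_sum fun c _ => (hA a c).mul (hB c b)

theorem EntryDiffAt.sub (hA : EntryDiffAt A z) (hB : EntryDiffAt B z) :
    EntryDiffAt (fun w => A w - B w) z :=
  fun a b => (hA a b).sub (hB a b)

theorem EntrySmoothAt.mul (hA : EntrySmoothAt A z) (hB : EntrySmoothAt B z) :
    EntrySmoothAt (fun w => A w * B w) z := by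
  intro a b
  simp only [Matrix.mul_apply]
  exact ContDiffAt.sum fun c _ => (hA a c).mul (hB c b)

theorem contDiffAt_det {N : ℕ∞ω} (hA : ∀ a b, ContDiffAt ℝ N (fun w => A w a b) z) :
    ContDiffAt ℝ N (fun w => (A w).det) z := by
  simp only [Matrix.det_apply]
  exact ContDiffAt.sum fun s _ => (contDiffAt_prod fun i _ => hA _ _).const_smul _

theorem contDiffAt_inv_entry {N : ℕ∞ω} (hA : ∀ a b, ContDiffAt ℝ N (fun w => A w a b) z)
    (hu : IsUnit (A z)) (a b : Fin m) : ContDiffAt ℝ N (fun w => (A w)⁻¹ a b) z := by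
  have hd : (A z).det ≠ 0 := ((Matrix.isUnit_iff_isUnit_det _).1 hu).ne_zero
  simp only [Matrix.inv_def, Ring.inverse_eq_inv', Matrix.smul_apply, smul_eq_mul,
    Matrix.adjugate_apply]
  refine ((contDiffAt_det hA).inv hd).mul (contDiffAt_det fun c d => ?_)
  -- By Cramer's rule the entry is a determinant with row `b` replaced by a constant vector, divided
  -- by det A.
  by_cases hc : c = b
  · subst hc
    simpa using contDiffAt_const
  · simpa [Matrix.updateRow_ne hc] using hA c d

theorem EntrySmoothAt.inv (hA : EntrySmoothAt A z) (hu : IsUnit (A z)) :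
    EntrySmoothAt (fun w => (A w)⁻¹) z :=
  fun a b => contDiffAt_inv_entry hA hu a b

theorem Filter.EventuallyEq.matDeriv_eq (h : A =ᶠ[nhds z] B) : matDeriv L A z = matDeriv L B z := by
  ext a b
  have : (fun w => A w a b) =ᶠ[nhds z] fun w => B w a b := h.mono fun w hw => by simp only [hw]
  simp only [matDeriv, Matrix.of_apply, this.fderiv_eq]

/-- Since `L` is ℂ-linear on the real derivative, a single Leibniz rule serves ∂_j, ∂_k̄ and the
time derivative. -/
theorem matDeriv_mul (hA : EntryDiffAt A z) (hB : EntryDiffAt B z) :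
    matDeriv L (fun w => A w * B w) z = matDeriv L A z * B z + A z * matDeriv L B z := by
  ext a b
  simp only [matDeriv, Matrix.of_apply, Matrix.mul_apply, Matrix.add_apply]
  rw [fderiv_fun_sum fun c _ => (hA a c).fun_mul (hB c b), map_sum, ← Finset.sum_add_distrib]
  refine Finset.sum_congr rfl fun c _ => ?_
  rw [fderiv_fun_mul (hA a c) (hB c b), map_add, map_smul, map_smul, smul_eq_mul, smul_eq_mul]
  ring

theorem matDeriv_sub (hA : EntryDiffAt A z) (hB : EntryDiffAt B z) :
    matDeriv L (fun w => A w - B w) z = matDeriv L A z - matDeriv L B z := by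
  ext a b
  simp only [matDeriv, Matrix.of_apply, Matrix.sub_apply]
  rw [fderiv_fun_sub (hA a b) (hB a b), map_sub]

theorem matDeriv_const (K : Matrix (Fin m) (Fin m) ℂ) : matDeriv L (fun _ : V => K) z = 0 := by
  ext a b
  simp [matDeriv]

theorem trace_matDeriv (hA : EntryDiffAt A z) :
    (matDeriv L A z).trace = L (fderiv ℝ (fun w => (A w).trace) z) := by
  simp only [Matrix.trace, Matrix.diag_apply, matDeriv, Matrix.of_apply]
  rw [fderiv_fun_sum fun c _ => hA c c, map_sum]

theorem matDeriv_inv (hA : EntryDiffAt A z) (hi : EntryDiffAt (fun w => (A w)⁻¹) z)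
    (hu : ∀ᶠ w in nhds z, IsUnit (A w)) :
    matDeriv L (fun w => (A w)⁻¹) z = -((A z)⁻¹ * matDeriv L A z * (A z)⁻¹) := by
  have hdet : ∀ w, IsUnit (A w) → IsUnit (A w).det := fun w => (Matrix.isUnit_iff_isUnit_det _).1
  have e : (fun w => (A w)⁻¹ * A w) =ᶠ[nhds z] fun _ => 1 :=
    hu.mono fun w hw => Matrix.nonsing_inv_mul _ (hdet w hw)
  have h := (e.matDeriv_eq (L := L)).symm
  rw [matDeriv_mul hi hA, matDeriv_const] at h
  have h2 := congrArg (· * (A z)⁻¹) h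
  simp only [zero_mul, add_mul, mul_assoc,
    Matrix.mul_nonsing_inv _ (hdet z hu.self_of_nhds), mul_one] at h2
  rw [mul_assoc]
  exact eq_neg_of_add_eq_zero_left h2.symm

end EntrywiseCalculus

/-! ### Wirtinger derivatives as functionals of the real derivative -/

section Wirtinger

variable {n : ℕ}

/-- The functional `ℓ ↦ ½ (ℓ v + c ℓ (i v))`. -/
noncomputable def wirtinger (c : ℂ) (v : CSpace n) : (CSpace n →L[ℝ] ℂ) →ₗ[ℂ] ℂ where
  toFun f := (1 / 2) * (f v + c * f (Complex.I • v))
  map_add' f g := by simp only [add_apply]; ring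
  map_smul' a f := by simp only [smul_apply, smul_eq_mul, RingHom.id_apply]; ring

theorem dZ_eq (j : Fin n) (f : CSpace n → ℂ) (z : CSpace n) :
    dZ j f z = wirtinger (-Complex.I) (stdVec j) (fderiv ℝ f z) := by
  simp [dZ, wirtinger, sub_eq_add_neg]

theorem dZbar_eq (j : Fin n) (f : CSpace n → ℂ) (z : CSpace n) :
    dZbar j f z = wirtinger Complex.I (stdVec j) (fderiv ℝ f z) := rfl

theorem matDZ_eq {r : ℕ} (j : Fin n) (A : CSpace n → Matrix (Fin r) (Fin r) ℂ) :
    matDZ j A = matDeriv (wirtinger (-Complex.I) (stdVec j)) A := by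
  funext z; ext a b; exact dZ_eq _ _ _

theorem matDZbar_eq {r : ℕ} (j : Fin n) (A : CSpace n → Matrix (Fin r) (Fin r) ℂ) :
    matDZbar j A = matDeriv (wirtinger Complex.I (stdVec j)) A := rfl

theorem EntrySmoothAt.matDZ {r : ℕ} {A : CSpace n → Matrix (Fin r) (Fin r) ℂ} {z : CSpace n}
    (hA : EntrySmoothAt A z) (j : Fin n) : EntrySmoothAt (matDZ j A) z := by
  intro a b
  have h : ContDiffAt ℝ ∞ (fderiv ℝ fun w => A w a b) z := (hA a b).fderiv_right (by simp)
  simp only [_root_.matDZ, Matrix.of_apply, dZ]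
  exact contDiffAt_const.mul ((h.clm_apply contDiffAt_const).sub
    (contDiffAt_const.mul (h.clm_apply contDiffAt_const)))

theorem matDZbar_eq_conjTranspose {r : ℕ} {A : CSpace n → Matrix (Fin r) (Fin r) ℂ}
    {z : CSpace n} (hA : ∀ᶠ w in nhds z, (A w).IsHermitian) (hd : EntryDiffAt A z) (j : Fin n) :
    matDZbar j A z = (matDZ j A z).conjTranspose := by
  ext a b
  have e : (fun w => A w a b) =ᶠ[nhds z] fun w => conj (A w b a) :=
    hA.mono fun w hw => (hw.apply a b).symm
  have hf : HasFDerivAt (fun w => conj (A w b a))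
      ((Complex.conjCLE : ℂ →L[ℝ] ℂ).comp (fderiv ℝ (fun w => A w b a) z)) z :=
    (Complex.conjCLE : ℂ →L[ℝ] ℂ).hasFDerivAt.comp z (hd b a).hasFDerivAt
  simp only [matDZbar, matDZ, Matrix.of_apply, Matrix.conjTranspose_apply, dZ, dZbar]
  rw [e.fderiv_eq, hf.fderiv]
  simp

end Wirtinger

/-! ### Second derivatives at a local maximum -/

section SecondDerivative

theorem deriv_deriv_nonpos_of_isLocalMax {f : ℝ → ℝ} {x : ℝ} (hf : ContDiffAt ℝ 2 f x)
    (hm : IsLocalMax f x) : deriv (deriv f) x ≤ 0 := by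
  by_contra! hpos
  set a := deriv (deriv f) x with ha
  -- The second derivative test yields only a weak minimum. The subtracted term uses up half of the
  -- assumed a > 0, so `g` still has a local minimum at x, that is f(y) ≥ f(x) + (a/4)(y − x)²
  -- nearby, which is incompatible with a maximum of f at x.
  let g : ℝ → ℝ := fun y => f y - a / 4 * (y - x) ^ 2
  have hd : ∀ᶠ y in nhds x, DifferentiableAt ℝ f y :=
    (hf.eventually (by simp)).mono fun y hy => hy.differentiableAt (by simp)
  have hg1 : deriv g =ᶠ[nhds x] fun y => deriv f y - a / 2 * (y - x) := by
    refine hd.mono fun y hy => ?_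
    have : HasDerivAt g (deriv f y - a / 4 * (2 * (y - x))) y := by
      have h2 := (((hasDerivAt_id y).sub_const x).pow 2).const_mul (a / 4)
      refine (hy.hasDerivAt.sub h2).congr_deriv ?_
      simp
    rw [this.deriv]; ring
  have hdd : DifferentiableAt ℝ (deriv f) x := by
    have h1 : ContDiffAt ℝ 1 (fderiv ℝ f) x := hf.fderiv_right (by norm_num)
    exact (h1.differentiableAt (by simp)).clm_apply (differentiableAt_const _)
  have hg2 : deriv (deriv g) x = a / 2 := by
    rw [hg1.deriv_eq]
    have h3 := hdd.hasDerivAt.sub (((hasDerivAt_id x).sub_const x).const_mul (a / 2))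
    refine h3.deriv.trans ?_
    rw [← ha]; ring
  have hg0 : deriv g x = 0 := by
    rw [hg1.eq_of_nhds, hm.deriv_eq_zero]; simp
  have hcont : ContinuousAt g x := by
    have := hf.continuousAt
    fun_prop
  have hmin := isLocalMin_of_deriv_deriv_pos (by rw [hg2]; linarith) hg0 hcont
  obtain ⟨y, ⟨hy1, hy2⟩, hy3⟩ :=
    (((hmin.and hm).filter_mono nhdsWithin_le_nhds).and
      (self_mem_nhdsWithin : {x}ᶜ ∈ nhdsWithin x {x}ᶜ)).exists
  have hne : 0 < (y - x) ^ 2 := by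
    have : y - x ≠ 0 := sub_ne_zero.2 hy3
    positivity
  simp only [g, sub_self] at hy1
  nlinarith

variable {V : Type*} [NormedAddCommGroup V] [NormedSpace ℝ V]

theorem re_fderiv_fderiv_nonpos_of_isLocalMax {s : V → ℂ} {z : V} (hs : ContDiffAt ℝ 2 s z)
    (hm : IsLocalMax (fun w => (s w).re) z) (v : V) :
    (fderiv ℝ (fderiv ℝ s) z v v).re ≤ 0 := by
  let l : ℝ → V := fun y => z + y • v
  have hl : ∀ y, HasDerivAt l v y := fun y => by
    exact (((hasDerivAt_id y).smul_const v).const_add z).congr_deriv (one_smul ℝ v)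
  have hlc : ContDiff ℝ 2 l := by fun_prop
  have hl0 : l 0 = z := by simp [l]
  have hs' : ContDiffAt ℝ 2 s (l 0) := by rwa [hl0]
  let f : ℝ → ℝ := fun y => (s (l y)).re
  have hf : ContDiffAt ℝ 2 f 0 :=
    Complex.reCLM.contDiff.contDiffAt.comp (0 : ℝ) (hs'.comp (0 : ℝ) hlc.contDiffAt)
  have hlt : Filter.Tendsto l (nhds 0) (nhds z) := by
    have := hlc.continuous.tendsto 0
    rwa [hl0] at this
  have hfm : IsLocalMax f 0 := by
    have := hlt.eventually hm
    refine this.mono fun y hy => ?_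
    simpa [f, hl0] using hy
  have hf1 : deriv f =ᶠ[nhds 0] fun y => (fderiv ℝ s (l y) v).re := by
    have h1 := hlt.eventually (hs.eventually (by simp))
    refine h1.mono fun y hy => ?_
    have h2 := (hy.differentiableAt (by simp)).hasFDerivAt.comp_hasDerivAt y (hl y)
    exact (Complex.reCLM.hasFDerivAt.comp_hasDerivAt y h2).deriv
  have hf2 : deriv (deriv f) 0 = (fderiv ℝ (fderiv ℝ s) z v v).re := by
    rw [hf1.deriv_eq]
    have h1 : ContDiffAt ℝ 1 (fderiv ℝ s) (l 0) := hs'.fderiv_right (by norm_num)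
    have h2 := (h1.differentiableAt (by simp)).hasFDerivAt.comp_hasDerivAt 0 (hl 0)
    have h3 := h2.clm_apply (hasDerivAt_const 0 v)
    have h4 := (Complex.reCLM.hasFDerivAt.comp_hasDerivAt 0 h3).deriv
    refine h4.trans ?_
    simp [hl0]
  rw [← hf2]
  exact deriv_deriv_nonpos_of_isLocalMax hf hfm

end SecondDerivative

/-! ### Complex Hessian and the heat inequality for tr(g⁻¹h) -/

section HeatInequality

open scoped ComplexOrder

variable {n : ℕ}

/-- The complex Hessian `4 ∂_v̄ ∂_w` of a real bilinear form, as a sesquilinear form. -/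
noncomputable def complexHessian (b : CSpace n →ₗ[ℝ] CSpace n →ₗ[ℝ] ℂ) :
    CSpace n →ₗ⋆[ℂ] CSpace n →ₗ[ℂ] ℂ :=
  LinearMap.mk₂'ₛₗ (starRingEnd ℂ) (RingHom.id ℂ)
    (fun v w => b v w - Complex.I * b v (Complex.I • w) + Complex.I * b (Complex.I • v) w +
      b (Complex.I • v) (Complex.I • w))
    (fun v v' w => by simp only [smul_add, map_add, LinearMap.add_apply]; ring)
    (fun c v w => by
      have h1 : c • v = c.re • v + c.im • (Complex.I • v) := by
        rw [← Complex.coe_smul, ← Complex.coe_smul c.im, smul_smul, ← add_smul,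
          Complex.re_add_im]
      have h2 : Complex.I • c • v = c.re • (Complex.I • v) - c.im • v := by
        rw [h1, smul_add, smul_comm Complex.I, smul_comm Complex.I c.im, smul_smul,
          Complex.I_mul_I]
        simp [sub_eq_add_neg]
      rw [h2, h1]
      simp only [map_add, map_sub, map_smul, LinearMap.add_apply, LinearMap.sub_apply,
        LinearMap.smul_apply, smul_eq_mul,
        Complex.real_smul]
      conv_rhs => rw [← Complex.re_add_im c]
      simp only [map_add, map_mul, Complex.conj_ofReal, Complex.conj_I]
      linear_combination ((c.im : ℂ) * b (Complex.I • v) w -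
        (c.im : ℂ) * b v (Complex.I • w)) * Complex.I_sq)
    (fun v w w' => by simp only [smul_add, map_add]; ring)
    (fun c v w => by
      have h1 : c • w = c.re • w + c.im • (Complex.I • w) := by
        rw [← Complex.coe_smul, ← Complex.coe_smul c.im, smul_smul, ← add_smul,
          Complex.re_add_im]
      have h2 : Complex.I • c • w = c.re • (Complex.I • w) - c.im • w := by
        rw [h1, smul_add, smul_comm Complex.I, smul_comm Complex.I c.im, smul_smul,
          Complex.I_mul_I]
        simp [sub_eq_add_neg]
      rw [h2, h1]
      simp only [map_add, map_sub, map_smul, smul_eq_mul, Complex.real_smul, RingHom.id_apply]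
      conv_rhs => rw [← Complex.re_add_im c]
      linear_combination ((c.im : ℂ) * b v (Complex.I • w) -
        (c.im : ℂ) * b (Complex.I • v) w) * Complex.I_sq)

theorem complexHessian_apply (b : CSpace n →ₗ[ℝ] CSpace n →ₗ[ℝ] ℂ) (v w : CSpace n) :
    complexHessian b v w = b v w - Complex.I * b v (Complex.I • w) +
      Complex.I * b (Complex.I • v) w + b (Complex.I • v) (Complex.I • w) := rfl

theorem complexHessian_sum_smul {ι : Type*} [Fintype ι] (b : CSpace n →ₗ[ℝ] CSpace n →ₗ[ℝ] ℂ)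
    (c : ι → ℂ) (v : ι → CSpace n) :
    complexHessian b (∑ j, c j • v j) (∑ j, c j • v j) =
      ∑ j, ∑ k, conj (c k) * c j * complexHessian b (v k) (v j) := by
  simp only [map_sum, LinearMap.sum_apply, LinearMap.map_smulₛₗ, LinearMap.smul_apply,
    smul_eq_mul, RingHom.id_apply]
  refine Finset.sum_congr rfl fun j _ => ?_
  rw [Finset.mul_sum]
  exact Finset.sum_congr rfl fun k _ => by ring

/-- The second derivative as a real bilinear form. -/
noncomputable def hessian (s : CSpace n → ℂ) (z : CSpace n) :
    CSpace n →ₗ[ℝ] CSpace n →ₗ[ℝ] ℂ :=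
  LinearMap.mk₂ ℝ (fun v w => fderiv ℝ (fderiv ℝ s) z v w) (by simp) (by simp) (by simp) (by simp)

theorem hessian_apply (s : CSpace n → ℂ) (z v w : CSpace n) :
    hessian s z v w = fderiv ℝ (fderiv ℝ s) z v w := rfl

theorem dZbar_dZ_eq {s : CSpace n → ℂ} {z : CSpace n} (hs : ContDiffAt ℝ 2 s z) (j k : Fin n) :
    dZbar k (dZ j s) z =
      (1 / 4) * complexHessian (hessian s z) (stdVec k) (stdVec j) := by
  have h1 : ContDiffAt ℝ 1 (fderiv ℝ s) z := hs.fderiv_right (by norm_num)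
  have h2 := (h1.differentiableAt (by simp)).hasFDerivAt
  have h3 : ∀ v, HasFDerivAt (fun w => fderiv ℝ s w v)
      ((fderiv ℝ (fderiv ℝ s) z).flip v) z := fun v => by
    simpa using h2.clm_apply (hasFDerivAt_const v z)
  have h4 : HasFDerivAt (dZ j s) _ z :=
    ((h3 (stdVec j)).sub ((h3 (Complex.I • stdVec j)).const_mul Complex.I)).const_mul (1 / 2)
  rw [dZbar, h4.fderiv, complexHessian_apply]
  simp only [hessian_apply, smul_apply, sub_apply, ContinuousLinearMap.flip_apply, smul_eq_mul]
  linear_combination (-(1 / 4 : ℂ) * fderiv ℝ (fderiv ℝ s) z (Complex.I • stdVec k)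
    (Complex.I • stdVec j)) * Complex.I_sq

/-- Factoring M = C*C turns the contraction into a sum of values of the complex Hessian on the
diagonal at the vectors u_l = Σ_j C_lj e_j. On the diagonal it is the real Hessian at u plus that at
iu, and both are nonpositive at a maximum. -/
theorem re_sum_dZbar_dZ_nonpos {s : CSpace n → ℂ} {z : CSpace n} (hs : ContDiffAt ℝ 2 s z)
    (hm : IsLocalMax (fun w => (s w).re) z) {M : Matrix (Fin n) (Fin n) ℂ} (hM : M.PosSemidef) :
    (∑ j, ∑ k, M k j * dZbar k (dZ j s) z).re ≤ 0 := by
  obtain ⟨C, rfl⟩ := hM.exists_eq_conjTranspose_mul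
  have hsymm : IsSymmSndFDerivAt ℝ s z := hs.isSymmSndFDerivAt (by simp)
  let u : Fin n → CSpace n := fun l => ∑ j, C l j • stdVec j
  have e : ∑ j, ∑ k, (C.conjTranspose * C) k j * dZbar k (dZ j s) z =
      (1 / 4) * ∑ l, complexHessian (hessian s z) (u l) (u l) := by
    simp only [u, complexHessian_sum_smul, dZbar_dZ_eq hs, Matrix.mul_apply,
      Matrix.conjTranspose_apply, Finset.sum_mul,
      Finset.mul_sum]
    rw [Finset.sum_comm (s := (Finset.univ : Finset (Fin n)))
      (f := fun l j => ∑ k, (1 / 4 : ℂ) *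
        (conj (C l k) * C l j * complexHessian (hessian s z) (stdVec k) (stdVec j)))]
    refine Finset.sum_congr rfl fun j _ => ?_
    rw [Finset.sum_comm]
    refine Finset.sum_congr rfl fun l _ => Finset.sum_congr rfl fun k _ => ?_
    simp only [RCLike.star_def]
    ring
  rw [e, show (1 / 4 : ℂ) = ((1 / 4 : ℝ) : ℂ) by norm_num, Complex.re_ofReal_mul, Complex.re_sum]
  refine mul_nonpos_of_nonneg_of_nonpos (by norm_num) (Finset.sum_nonpos fun l _ => ?_)
  have h2 := re_fderiv_fderiv_nonpos_of_isLocalMax hs hm (u l)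
  have h3 := re_fderiv_fderiv_nonpos_of_isLocalMax hs hm (Complex.I • u l)
  have h4 : hessian s z (Complex.I • u l) (u l) = hessian s z (u l) (Complex.I • u l) := hsymm _ _
  -- Symmetry of the second derivative cancels the two mixed terms carrying the factor i.
  rw [complexHessian_apply, h4]
  simp only [sub_add_cancel, Complex.add_re, hessian_apply]
  linarith

variable {r : ℕ} {g h : CSpace n → Matrix (Fin r) (Fin r) ℂ} {z : CSpace n}

theorem EntrySmoothAt.trace {A : CSpace n → Matrix (Fin r) (Fin r) ℂ} (hA : EntrySmoothAt A z) :
    ContDiffAt ℝ ∞ (fun w => (A w).trace) z := by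
  simp only [Matrix.trace, Matrix.diag_apply]
  exact ContDiffAt.sum fun a _ => hA a a

theorem EntrySmoothAt.eventually {A : CSpace n → Matrix (Fin r) (Fin r) ℂ}
    (hA : EntrySmoothAt A z) : ∀ᶠ w in nhds z, EntryDiffAt A w := by
  simp only [EntryDiffAt, Filter.eventually_all]
  intro a b
  have h1 : ContDiffAt ℝ 1 (fun w => A w a b) z := (hA a b).of_le (by simp)
  exact (h1.eventually (by simp)).mono fun w hw => hw.differentiableAt (by simp)

/-- A Bochner-type formula: the trace of the curvature difference against g⁻¹h is the complex
Hessian of tr(g⁻¹h) minus a term quadratic in the difference of the two Chern connection forms. The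
adjoint appears because ∂_k̄ of a Hermitian matrix is the adjoint of its ∂_k. -/
theorem trace_curvature_difference (hg : EntrySmoothAt g z) (hh : EntrySmoothAt h z)
    (pg : ∀ᶠ w in nhds z, (g w).PosDef) (ph : ∀ᶠ w in nhds z, (h w).PosDef) (j k : Fin n) :
    ((g z)⁻¹ * h z * (matDZbar k (fun w => (h w)⁻¹ * matDZ j h w) z -
        matDZbar k (fun w => (g w)⁻¹ * matDZ j g w) z)).trace =
      dZbar k (dZ j fun w => ((g w)⁻¹ * h w).trace) z -
      ((g z)⁻¹ * (matDZ k h z - h z * (g z)⁻¹ * matDZ k g z).conjTranspose * (h z)⁻¹ *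
        (matDZ j h z - h z * (g z)⁻¹ * matDZ j g z)).trace := by
  have ug : ∀ᶠ w in nhds z, IsUnit (g w) := pg.mono fun w hw => hw.isUnit
  have uh : ∀ᶠ w in nhds z, IsUnit (h w) := ph.mono fun w hw => hw.isUnit
  have sg := hg.inv ug.self_of_nhds
  have sh := hh.inv uh.self_of_nhds
  have dg := hg.entryDiffAt
  have dh := hh.entryDiffAt
  have dgj := (hg.matDZ j).entryDiffAt
  have dhj := (hh.matDZ j).entryDiffAt
  have dig := sg.entryDiffAt
  have dih := sh.entryDiffAt
  -- The formula for ∂_jσ is needed on a neighbourhood, as it is differentiated once more.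
  have e3 : (dZ j fun w => ((g w)⁻¹ * h w).trace) =ᶠ[nhds z]
      fun w => ((g w)⁻¹ * (matDZ j h w - matDZ j g w * (g w)⁻¹ * h w)).trace := by
    filter_upwards [hg.eventually, hh.eventually, sg.eventually, ug.eventually_nhds]
      with w h1 h2 h3 h4
    rw [dZ_eq, ← trace_matDeriv (h3.mul h2), matDeriv_mul h3 h2, matDeriv_inv h1 h3 h4,
      matDZ_eq, matDZ_eq]
    congr 1
    simp only [mul_sub, neg_mul, mul_assoc]
    abel
  have dgp := dgj.mul dig
  have dgph := dgp.mul dh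
  have e4 : dZbar k (dZ j fun w => ((g w)⁻¹ * h w).trace) z =
      wirtinger Complex.I (stdVec k) (fderiv ℝ (fun w =>
        ((g w)⁻¹ * (matDZ j h w - matDZ j g w * (g w)⁻¹ * h w)).trace) z) := by
    rw [dZbar_eq, e3.fderiv_eq]
  rw [← trace_matDeriv (dig.mul (dhj.sub dgph)), matDeriv_mul dig (dhj.sub dgph),
    matDeriv_sub dhj dgph, matDeriv_mul dgp dh, matDeriv_mul dgj dig, matDeriv_inv dg dig ug] at e4
  have e5 : (matDZ k h z - h z * (g z)⁻¹ * matDZ k g z).conjTranspose =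
      matDZbar k h z - matDZbar k g z * (g z)⁻¹ * h z := by
    rw [Matrix.conjTranspose_sub, Matrix.conjTranspose_mul, Matrix.conjTranspose_mul,
      ← matDZbar_eq_conjTranspose (pg.mono fun w hw => hw.1) dg,
      ← matDZbar_eq_conjTranspose (ph.mono fun w hw => hw.1) dh,
      pg.self_of_nhds.inv.1.eq, ph.self_of_nhds.1.eq, mul_assoc]
  have hq : h z * (h z)⁻¹ = 1 :=
    Matrix.mul_nonsing_inv _ ((Matrix.isUnit_iff_isUnit_det _).1 uh.self_of_nhds)
  rw [e4, e5]
  simp only [matDZbar_eq]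
  rw [matDeriv_mul dih dhj, matDeriv_mul dig dgj, matDeriv_inv dg dig ug, matDeriv_inv dh dih uh,
    Matrix.trace_heat_identity hq]
  simp only [add_mul]

/-- At a spatial maximum of `tr (g⁻¹ h)` the reaction side of the heat equation is nonpositive. -/
theorem re_trace_curvature_difference_nonpos (hg : EntrySmoothAt g z) (hh : EntrySmoothAt h z)
    (pg : ∀ᶠ w in nhds z, (g w).PosDef) (ph : ∀ᶠ w in nhds z, (h w).PosDef)
    (hm : IsLocalMax (fun w => ((g w)⁻¹ * h w).trace.re) z)
    {M : Matrix (Fin n) (Fin n) ℂ} (hM : M.PosSemidef) :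
    (∑ j, ∑ k, M k j * ((g z)⁻¹ * h z * (matDZbar k (fun w => (h w)⁻¹ * matDZ j h w) z -
        matDZbar k (fun w => (g w)⁻¹ * matDZ j g w) z)).trace).re ≤ 0 := by
  have sg := hg.inv pg.self_of_nhds.isUnit
  have h1 := re_sum_dZbar_dZ_nonpos (contDiffAt_infty.1 (sg.mul hh).trace 2) hm hM
  have h2 : 0 ≤ (∑ j, ∑ k, M k j * ((g z)⁻¹ *
      (matDZ k h z - h z * (g z)⁻¹ * matDZ k g z).conjTranspose * (h z)⁻¹ *
        (matDZ j h z - h z * (g z)⁻¹ * matDZ j g z)).trace).re := by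
    obtain ⟨B, hB⟩ : ∃ B : Fin n → Matrix (Fin r) (Fin r) ℂ,
        ∀ j, matDZ j h z - h z * (g z)⁻¹ * matDZ j g z = B j := ⟨_, fun _ => rfl⟩
    simp only [hB]
    -- With M = C*C the double sum becomes Σ_l tr(g⁻¹D_l* h⁻¹D_l) for D_l = Σ_k C_lk B_k, and each
    -- summand is nonnegative.
    obtain ⟨C, rfl⟩ := hM.exists_eq_conjTranspose_mul
    have e : ∑ j, ∑ k, (C.conjTranspose * C) k j *
        ((g z)⁻¹ * (B k).conjTranspose * (h z)⁻¹ * B j).trace =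
        ∑ l, ((g z)⁻¹ * (∑ k, C l k • B k).conjTranspose * (h z)⁻¹ *
          (∑ j, C l j • B j)).trace := by
      simp only [Matrix.conjTranspose_sum, Matrix.conjTranspose_smul, Finset.sum_mul,
        Finset.mul_sum, Matrix.trace_sum, Matrix.mul_smul, Matrix.smul_mul, Matrix.trace_smul,
        smul_eq_mul, Matrix.mul_apply, Matrix.conjTranspose_apply]
      rw [Finset.sum_comm (s := (Finset.univ : Finset (Fin n)))
        (f := fun l j => ∑ k, C l j *
          (star (C l k) * ((g z)⁻¹ * (B k).conjTranspose * (h z)⁻¹ * B j).trace))]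
      refine Finset.sum_congr rfl fun j _ => ?_
      rw [Finset.sum_comm]
      exact Finset.sum_congr rfl fun l _ => Finset.sum_congr rfl fun k _ => by ring
    rw [e, Complex.re_sum]
    exact Finset.sum_nonneg fun l _ =>
      pg.self_of_nhds.inv.posSemidef.re_trace_mul_conj_nonneg ph.self_of_nhds.inv.posSemidef _
  simp only [trace_curvature_difference hg hh pg ph]
  simp only [mul_sub (M _ _), Finset.sum_sub_distrib, Complex.sub_re]
  linarith

end HeatInequality

/-! ### Parabolic maximum principle on a compact space -/

/-- Maximum principle: a function on `[0, ∞) × X` with nonpositive time derivative at its spatial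
maxima is bounded by its initial values. -/
theorem exists_bound_of_deriv_nonpos_at_max {X : Type*} [TopologicalSpace X] [CompactSpace X]
    {f : ℝ → X → ℝ}
    (hc : ContinuousOn (fun p : ℝ × X => f p.1 p.2) (Set.Ici 0 ×ˢ Set.univ))
    (hd : ∀ t, 0 < t → ∀ x, (∀ y, f t y ≤ f t x) →
      ∃ d ≤ 0, HasDerivAt (fun s => f s x) d t) :
    ∃ K, ∀ t, 0 ≤ t → ∀ x, f t x ≤ K := by
  have hc0 : Continuous (f 0) := by
    rw [← continuousOn_univ]
    exact hc.comp (f := fun x : X => ((0 : ℝ), x)) (by fun_prop) (fun x _ => by simp)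
  obtain ⟨K, hK⟩ := isCompact_univ.bddAbove_image hc0.continuousOn
  have hK' : ∀ x, f 0 x ≤ K := fun x => hK ⟨x, Set.mem_univ _, rfl⟩
  refine ⟨K, fun T hT x => ?_⟩
  have key : ∀ ε : ℝ, 0 < ε → f T x ≤ K + ε * T := by
    intro ε hε
    have hcomp : IsCompact (Set.Icc 0 T ×ˢ (Set.univ : Set X)) := isCompact_Icc.prod isCompact_univ
    -- Subtracting εt makes the time derivative strictly negative at a spatial maximum, so the
    -- maximum over [0,T] × X can only occur at time 0.
    have hF : ContinuousOn (fun p : ℝ × X => f p.1 p.2 - ε * p.1)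
        (Set.Icc 0 T ×ˢ (Set.univ : Set X)) :=
      (hc.mono (Set.prod_mono Set.Icc_subset_Ici_self le_rfl)).sub (by fun_prop)
    obtain ⟨⟨t, y⟩, ⟨ht, -⟩, hmax⟩ := hcomp.exists_isMaxOn
      ⟨(T, x), Set.mk_mem_prod ⟨hT, le_rfl⟩ (Set.mem_univ _)⟩ hF
    have hmax' : ∀ s ∈ Set.Icc 0 T, ∀ y', f s y' - ε * s ≤ f t y - ε * t :=
      fun s hs y' => hmax (Set.mk_mem_prod hs (Set.mem_univ y'))
    have hT' := hmax' T ⟨hT, le_rfl⟩ x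
    rcases ht.1.eq_or_lt with h0 | h0
    · subst h0
      have := hK' y
      linarith
    · exfalso
      obtain ⟨d, hd0, hd1⟩ := hd t h0 y fun y' => by
        have := hmax' t ht y'
        linarith
      have hF1 : HasDerivAt (fun s => f s y - ε * s) (d - ε) t := by
        exact (hd1.sub ((hasDerivAt_id t).const_mul ε)).congr_deriv (by ring)
      -- Slopes are taken from the left because the maximum may lie at the final time T.
      have hsl := (hasDerivWithinAt_iff_tendsto_slope' (s := Set.Iio t) (by simp)).1
        hF1.hasDerivWithinAt
      have : 0 ≤ d - ε := by
        refine ge_of_tendsto hsl ?_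
        filter_upwards [Ioo_mem_nhdsLT h0] with s hs
        rw [slope_def_field]
        have := hmax' s ⟨hs.1.le, hs.2.le.trans ht.2⟩ y
        exact div_nonneg_of_nonpos (by linarith) (by linarith [hs.2])
      linarith
  by_contra! hlt
  have hpos : 0 < f T x - K := by linarith
  -- This ε makes εT at most half of the supposed excess; `T + 1` keeps the quotient meaningful at T
  -- = 0.
  have := key ((f T x - K) / (2 * (T + 1))) (by positivity)
  have h2 : (f T x - K) / (2 * (T + 1)) * T ≤ (f T x - K) / 2 := by
    rw [div_mul_eq_mul_div, div_le_div_iff₀ (by positivity) (by positivity)]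
    nlinarith
  linarith

/-! ### Positivity of the Kähler matrix -/

section KaehlerForm

open scoped ComplexOrder

/-- The form b(u,v) = β(u,iv) is real bilinear, and the matrix is ¼ of its complex Hessian with
indices exchanged. Its quadratic form at x is therefore ½ β(u,iu) with u = Σ_j x̄_j e_j; the
conjugates account for the exchange. -/
theorem posSemidef_of_twoForm {n : ℕ} (β : CSpace n [⋀^Fin 2]→L[ℝ] ℝ)
    (h11 : ∀ u v, β ![Complex.I • u, Complex.I • v] = β ![u, v])
    (hp : ∀ v, 0 ≤ β ![v, Complex.I • v]) :
    (Matrix.of fun j k : Fin n => (1 / 2 : ℂ) * ((β ![stdVec j, Complex.I • stdVec k] : ℂ) -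
      Complex.I * (β ![stdVec j, stdVec k] : ℂ))).PosSemidef := by
  have hanti : ∀ u v, β ![u, v] = -β ![v, u] := by
    intro u v
    have h := β.toAlternatingMap.map_swap ![v, u] (i := 0) (j := 1) (by simp)
    have e : ![v, u] ∘ Equiv.swap (0 : Fin 2) 1 = ![u, v] := by
      ext i : 1
      fin_cases i <;> simp
    rwa [e] at h
  have hadd : ∀ u u' v, β ![u + u', v] = β ![u, v] + β ![u', v] := fun u u' v =>
    β.vecCons_add ![v] u u'
  have hsmul : ∀ (c : ℝ) u v, β ![c • u, v] = c * β ![u, v] := fun c u v =>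
    β.vecCons_smul ![v] c u
  have hneg : ∀ u v, β ![-u, v] = -β ![u, v] := fun u v => by
    simpa using hsmul (-1) u v
  have hI : ∀ u v, β ![Complex.I • u, v] = -β ![u, Complex.I • v] := by
    intro u v
    rw [← h11 u, smul_smul, Complex.I_mul_I, neg_one_smul, hanti _ (-v), hneg, neg_neg, hanti]
  let b : CSpace n →ₗ[ℝ] CSpace n →ₗ[ℝ] ℂ :=
    LinearMap.mk₂ ℝ (fun u v => (β ![u, Complex.I • v] : ℂ))
      (fun u u' v => by rw [hadd]; push_cast; rfl)
      (fun c u v => by rw [hsmul]; push_cast; rfl)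
      (fun u v v' => by
        rw [smul_add, hanti, hadd, hanti u (_ • v), hanti u (_ • v')]; push_cast; ring)
      (fun c u v => by
        rw [smul_comm, hanti, hsmul, hanti u]
        simp only [Complex.real_smul]; push_cast; ring)
  have hb : ∀ u v, complexHessian b u v =
      2 * ((β ![u, Complex.I • v] : ℂ) + Complex.I * (β ![u, v] : ℂ)) := by
    intro u v
    have hb0 : ∀ u v, b u v = (β ![u, Complex.I • v] : ℂ) := fun _ _ => rfl
    have h1 : β ![u, Complex.I • Complex.I • v] = -β ![u, v] := by
      rw [smul_smul, Complex.I_mul_I, neg_one_smul, hanti, hneg, neg_neg, hanti v]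
    rw [complexHessian_apply, hb0, hb0, hb0, hb0, h11, h11, h1]
    push_cast
    ring
  have hM : ∀ j k, (1 / 2 : ℂ) * ((β ![stdVec j, Complex.I • stdVec k] : ℂ) -
      Complex.I * (β ![stdVec j, stdVec k] : ℂ)) =
      (1 / 4) * complexHessian b (stdVec k) (stdVec j) := by
    intro j k
    rw [hb, hanti (stdVec k), hI, hanti (stdVec k) (stdVec j)]
    push_cast
    ring
  refine Matrix.PosSemidef.of_dotProduct_mulVec_nonneg ?_ fun x => ?_
  · ext j k
    simp only [Matrix.conjTranspose_apply, Matrix.of_apply]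
    rw [hanti (stdVec k), hI, hanti (stdVec k) (stdVec j)]
    simp [sub_eq_add_neg]
  · have e : star x ⬝ᵥ (Matrix.of fun j k : Fin n =>
        (1 / 2 : ℂ) * ((β ![stdVec j, Complex.I • stdVec k] : ℂ) -
          Complex.I * (β ![stdVec j, stdVec k] : ℂ))).mulVec x =
        (1 / 4) * complexHessian b (∑ j, star x j • stdVec j) (∑ j, star x j • stdVec j) := by
      rw [complexHessian_sum_smul, Finset.mul_sum]
      simp only [hM, dotProduct, Matrix.mulVec, Matrix.of_apply, Finset.mul_sum, Pi.star_apply,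
        RCLike.star_def, Complex.conj_conj]
      refine Finset.sum_congr rfl fun j _ => Finset.sum_congr rfl fun k _ => by ring
    have h0 : ∀ u, β ![u, u] = 0 := fun u => by linarith [hanti u u]
    rw [e, hb, h0, Complex.le_def]
    have := hp (∑ j, star x j • stdVec j)
    constructor <;> simp
    simpa using this

theorem KaehlerForm.gram_posSemidef {n : ℕ} {X : Type*} [TopologicalSpace X]
    [ChartedSpace (CSpace n) X] (Ω : KaehlerForm n X)
    (φ : OpenPartialHomeomorph X (CSpace n)) (z : CSpace n) : (Ω.gram φ z).PosSemidef := by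
  obtain ⟨D, hD⟩ : ∃ D : CSpace n →ₗ[ℂ] TangentSpace 𝓘(ℂ, CSpace n) (φ.symm z),
      ∀ u v, Ω.form.inChart φ z ![u, v] = Ω.form (φ.symm z) ![D u, D v] := by
    refine ⟨(mfderiv 𝓘(ℂ, CSpace n) 𝓘(ℂ, CSpace n) φ.symm z).toLinearMap, fun u v => ?_⟩
    change Ω.form (φ.symm z) (fun i => mfderiv 𝓘(ℂ, CSpace n) 𝓘(ℂ, CSpace n) φ.symm z
      (![u, v] i)) = _
    congr 1
    ext i : 1
    fin_cases i <;> rfl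
  refine posSemidef_of_twoForm _ (fun u v => ?_) fun v => ?_
  · rw [hD, hD, map_smul, map_smul]
    exact Ω.type_one_one _ _ _
  · rw [hD, map_smul]
    -- At an arbitrary z the derivative need not be injective, for instance when it takes the
    -- default value 0; vectors in its kernel contribute 0.
    by_cases hv : D v = 0
    · rw [hv, smul_zero]
      exact ((Ω.form (φ.symm z)).map_coord_zero 0 rfl).ge
    · exact (Ω.pos _ _ hv).le

end KaehlerForm

/-! ### Gram matrices in local frames and frame independence of the trace -/

theorem symm_eq_sum_frameVec {r : ℕ} {X : Type*} [TopologicalSpace X] {E : X → Type*}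
    [∀ x, AddCommGroup (E x)] [∀ x, Module ℂ (E x)] [∀ x, TopologicalSpace (E x)]
    [TopologicalSpace (TotalSpace (Fin r → ℂ) E)] [FiberBundle (Fin r → ℂ) E]
    [VectorBundle ℂ (Fin r → ℂ) E] (e : Trivialization (Fin r → ℂ) (π (Fin r → ℂ) E))
    [MemTrivializationAtlas e] {x : X} (hx : x ∈ e.baseSet) (v : Fin r → ℂ) :
    e.symm x v = ∑ a, v a • frameVec e x a := by
  have h1 := fun y => (e.symmₗ_apply (R := ℂ) hx y).symm
  simp only [frameVec, h1, ← map_smul, ← map_sum]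
  congr 1
  ext b
  simp [Finset.sum_apply, Pi.single_apply]

section Fibre

open scoped ComplexOrder

variable {n r : ℕ} {X : Type*} [TopologicalSpace X] [ChartedSpace (CSpace n) X]
  {E : X → Type*} [∀ x, AddCommGroup (E x)] [∀ x, Module ℂ (E x)] [∀ x, TopologicalSpace (E x)]
  [TopologicalSpace (TotalSpace (Fin r → ℂ) E)] [FiberBundle (Fin r → ℂ) E]

namespace HermitianMetric

/-- The Gram matrix of `h` at `x` in the frame given by `e`. -/
noncomputable def gramAt (h : HermitianMetric n r E)
    (e : Trivialization (Fin r → ℂ) (π (Fin r → ℂ) E)) (x : X) : Matrix (Fin r) (Fin r) ℂ :=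
  Matrix.of fun a b => h.inner x (frameVec e x a) (frameVec e x b)

variable (h g : HermitianMetric n r E) (e e' : Trivialization (Fin r → ℂ) (π (Fin r → ℂ) E)) {x : X}

/-- `Re tr (g⁻¹ h)` at `x`. -/
noncomputable def relTrace (g h : HermitianMetric n r E) (x : X) : ℝ :=
  ((g.gramAt (trivializationAt (Fin r → ℂ) E x) x)⁻¹ *
    h.gramAt (trivializationAt (Fin r → ℂ) E x) x).trace.re

theorem sq_nonneg (x : X) (v : E x) : 0 ≤ g.sq x v := by
  by_cases hv : v = 0
  · simp [sq, hv]
  · exact (g.pos x v hv).le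

theorem mat_eq_gramAt (φ : OpenPartialHomeomorph X (CSpace n)) (z : CSpace n) :
    h.mat φ e z = h.gramAt e (φ.symm z) := rfl

variable [MemTrivializationAtlas e]

theorem entrySmoothAt_mat (hx : x ∈ e.baseSet) :
    EntrySmoothAt (h.mat (chartAt (CSpace n) x) e) (chartAt (CSpace n) x x) := by
  intro a b
  have h1 := (h.smooth e a b).contMDiffAt (e.open_baseSet.mem_nhds hx)
  have h2 := (contMDiffAt_iff.1 h1).2
  simp only [mfld_simps] at h2
  exact h2.contDiffAt Filter.univ_mem

variable [VectorBundle ℂ (Fin r → ℂ) E]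

theorem inner_symm_symm (hx : x ∈ e.baseSet) (v w : Fin r → ℂ) :
    h.inner x (e.symm x v) (e.symm x w) = star v ⬝ᵥ (h.gramAt e x).mulVec w := by
  rw [symm_eq_sum_frameVec e hx, symm_eq_sum_frameVec e hx]
  simp only [map_sum, LinearMap.sum_apply, LinearMap.map_smulₛₗ, LinearMap.smul_apply,
    smul_eq_mul, RingHom.id_apply, dotProduct, Matrix.mulVec, gramAt, Matrix.of_apply,
    Pi.star_apply, RCLike.star_def, Finset.mul_sum]
  rw [Finset.sum_comm]
  exact Finset.sum_congr rfl fun a _ => Finset.sum_congr rfl fun b _ => by ring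

theorem gramAt_posDef (hx : x ∈ e.baseSet) : (h.gramAt e x).PosDef := by
  refine Matrix.PosDef.of_dotProduct_mulVec_pos ?_ fun v hv => ?_
  · ext a b
    exact h.conj_symm x _ _
  · rw [← inner_symm_symm h e hx]
    have hne : e.symm x v ≠ 0 := fun h0 => hv <| by
      rw [← e.symmₗ_apply (R := ℂ) hx] at h0
      rw [← e.linearMapAt_symmₗ (R := ℂ) hx v, h0, map_zero]
    have h1 := h.pos x _ hne
    have h2 := Complex.conj_eq_iff_im.1 (h.conj_symm x (e.symm x v) (e.symm x v))
    exact Complex.lt_def.2 ⟨h1, h2.symm⟩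

/-- The columns of A are the coordinates of the second frame in the first. The same A works for all
metrics, which is what makes tr(g⁻¹h) independent of the frame. -/
theorem exists_gramAt_eq (hx : x ∈ e.baseSet) :
    ∃ A : Matrix (Fin r) (Fin r) ℂ, ∀ h : HermitianMetric n r E,
      h.gramAt e' x = A.conjTranspose * h.gramAt e x * A := by
  have hc : ∀ b, frameVec e' x b = e.symm x (e.linearMapAt ℂ x (frameVec e' x b)) := fun b => by
    rw [← e.symmₗ_apply (R := ℂ) hx, e.symmₗ_linearMapAt hx]
  refine ⟨Matrix.of fun a b => e.linearMapAt ℂ x (frameVec e' x b) a, fun h => ?_⟩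
  ext a b
  rw [gramAt, Matrix.of_apply, hc a, hc b, inner_symm_symm h e hx, Matrix.mul_assoc]
  simp only [Matrix.mul_apply, dotProduct, Matrix.mulVec, Matrix.conjTranspose_apply,
    Matrix.of_apply, Pi.star_apply]

/-- A change of frame conjugates g⁻¹h. This replaces the frame chosen separately at each point in
`relTrace` by one frame fixed near a point, as continuity and differentiation require. -/
theorem relTrace_eq (hx : x ∈ e.baseSet) :
    relTrace g h x = ((g.gramAt e x)⁻¹ * h.gramAt e x).trace.re := by
  have hx0 := FiberBundle.mem_baseSet_trivializationAt' (F := Fin r → ℂ) (E := E) x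
  obtain ⟨A, hA⟩ := exists_gramAt_eq (n := n) e (trivializationAt (Fin r → ℂ) E x) hx
  -- A is invertible because A*GA, the Gram matrix of g in the other frame, is.
  have hdet : IsUnit A.det := by
    have := (Matrix.isUnit_iff_isUnit_det _).1 (g.gramAt_posDef _ hx0).isUnit
    rw [hA, Matrix.det_mul] at this
    exact isUnit_of_mul_isUnit_right this
  have hdet' : IsUnit A.conjTranspose.det := by
    rw [Matrix.det_conjTranspose]; exact hdet.star
  rw [relTrace, hA, hA, Matrix.mul_inv_rev, Matrix.mul_inv_rev]
  congr 1
  rw [show A⁻¹ * ((g.gramAt e x)⁻¹ * A.conjTranspose⁻¹) *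
      (A.conjTranspose * h.gramAt e x * A) =
      A⁻¹ * ((g.gramAt e x)⁻¹ * (A.conjTranspose⁻¹ * A.conjTranspose) * h.gramAt e x * A) by
        simp only [Matrix.mul_assoc],
    Matrix.trace_mul_comm, Matrix.nonsing_inv_mul _ hdet', Matrix.mul_one, Matrix.mul_assoc,
    Matrix.mul_nonsing_inv _ hdet, Matrix.mul_one]

theorem sq_le_relTrace_mul (x : X) (v : E x) : h.sq x v ≤ relTrace g h x * g.sq x v := by
  set e := trivializationAt (Fin r → ℂ) E x
  have hx : x ∈ e.baseSet := FiberBundle.mem_baseSet_trivializationAt' (F := Fin r → ℂ) (E := E) x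
  have hv : v = e.symm x (e.linearMapAt ℂ x v) := by
    rw [← e.symmₗ_apply (R := ℂ) hx, e.symmₗ_linearMapAt hx]
  rw [sq, sq, hv, inner_symm_symm h e hx, inner_symm_symm g e hx]
  exact (g.gramAt_posDef e hx).re_form_le_trace_mul (h.gramAt_posDef e hx).posSemidef _

end HermitianMetric

end Fibre

/-! ### Evolution of tr(g⁻¹h) along two Donaldson flows -/

section Flow

open scoped ComplexOrder

variable {n r : ℕ} {X : Type*} [TopologicalSpace X] [ChartedSpace (CSpace n) X]
  {E : X → Type*} [∀ x, AddCommGroup (E x)] [∀ x, Module ℂ (E x)] [∀ x, TopologicalSpace (E x)]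
  [TopologicalSpace (TotalSpace (Fin r → ℂ) E)] [FiberBundle (Fin r → ℂ) E]
  {Ω : KaehlerForm n X} {lam : ℂ} {g h : ℝ → HermitianMetric n r E}

namespace IsDonaldsonFlow

theorem continuousOn_gramAt (hh : IsDonaldsonFlow Ω lam h)
    (e : Trivialization (Fin r → ℂ) (π (Fin r → ℂ) E)) [MemTrivializationAtlas e] :
    ContinuousOn (fun p : ℝ × X => (h p.1).gramAt e p.2) (Set.Ici 0 ×ˢ e.baseSet) :=
  continuousOn_pi.2 fun a => continuousOn_pi.2 fun b => (hh.smooth e a b).continuousOn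

theorem entrySmoothAt_time (hh : IsDonaldsonFlow Ω lam h)
    (e : Trivialization (Fin r → ℂ) (π (Fin r → ℂ) E)) [MemTrivializationAtlas e] {x : X}
    (hx : x ∈ e.baseSet) {t : ℝ} (ht : 0 < t) :
    EntrySmoothAt (fun s => (h s).gramAt e x) t := by
  intro a b
  have h1 : ContMDiffOn 𝓘(ℝ, ℝ) (𝓘(ℝ, ℝ).prod 𝓘(ℝ, CSpace n)) ∞
      (fun s : ℝ => (s, x)) (Set.Ici 0) :=
    contMDiffOn_id.prodMk contMDiffOn_const
  have h2 := (hh.smooth e a b).comp h1 fun s hs => Set.mk_mem_prod hs hx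
  exact (contMDiffOn_iff_contDiffOn.1 h2).contDiffAt (Ici_mem_nhds ht)

variable [VectorBundle ℂ (Fin r → ℂ) E]

theorem continuousOn_relTrace (hg : IsDonaldsonFlow Ω lam g) (hh : IsDonaldsonFlow Ω lam h) :
    ContinuousOn (fun p : ℝ × X => (g p.1).relTrace (h p.1) p.2) (Set.Ici 0 ×ˢ Set.univ) := by
  rintro ⟨t, x⟩ ⟨ht, -⟩
  set e := trivializationAt (Fin r → ℂ) E x
  have hx : x ∈ e.baseSet := FiberBundle.mem_baseSet_trivializationAt' (F := Fin r → ℂ) (E := E) x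
  have hmem : ((t, x) : ℝ × X) ∈ Set.Ici (0 : ℝ) ×ˢ e.baseSet := ⟨ht, hx⟩
  have cg := hg.continuousOn_gramAt e _ hmem
  have ch := hh.continuousOn_gramAt e _ hmem
  have hinv : ContinuousAt Inv.inv ((g t).gramAt e x) :=
    continuousAt_matrix_inv _ (by
      rw [Ring.inverse_eq_inv']
      exact continuousAt_inv₀
        ((Matrix.isUnit_iff_isUnit_det _).1 ((g t).gramAt_posDef e hx).isUnit).ne_zero)
  have ci := ContinuousAt.comp_continuousWithinAt
    (f := fun p : ℝ × X => (g p.1).gramAt e p.2) (x := (t, x)) hinv cg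
  have ct : ContinuousWithinAt (fun p : ℝ × X =>
      (((g p.1).gramAt e p.2)⁻¹ * (h p.1).gramAt e p.2).trace.re)
      (Set.Ici 0 ×ˢ e.baseSet) (t, x) :=
    (Complex.continuous_re.comp continuous_id.matrix_trace).continuousAt.comp_continuousWithinAt
      (ci.mul ch)
  have ct' := ct.congr (g := fun p : ℝ × X => (g p.1).relTrace (h p.1) p.2)
    (fun p hp => HermitianMetric.relTrace_eq _ _ e hp.2) (HermitianMetric.relTrace_eq _ _ e hx)
  refine ct'.mono_of_mem_nhdsWithin ?_
  rw [nhdsWithin_prod_eq, nhdsWithin_univ]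
  exact Filter.prod_mem_prod self_mem_nhdsWithin (e.open_baseSet.mem_nhds hx)

end IsDonaldsonFlow

/-- The functional `ℓ ↦ ℓ 1`. -/
noncomputable def evalOne : (ℝ →L[ℝ] ℂ) →ₗ[ℂ] ℂ where
  toFun f := f 1
  map_add' _ _ := rfl
  map_smul' _ _ := rfl

theorem matDeriv_evalOne {A : ℝ → Matrix (Fin r) (Fin r) ℂ} {t : ℝ} (ht : 0 < t) :
    (Matrix.of fun a b => derivWithin (fun s => A s a b) (Set.Ici 0) t) =
      matDeriv evalOne A t := by
  ext a b
  simp only [matDeriv, Matrix.of_apply]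
  -- For t > 0 the one-sided derivative in the flow equation is the ordinary one.
  rw [derivWithin_of_mem_nhds (Ici_mem_nhds ht)]
  rfl

variable [VectorBundle ℂ (Fin r → ℂ) E]

/-- The flow equations express the time derivative through the difference of the contracted
curvatures, whose sign at a spatial maximum is given by `re_trace_curvature_difference_nonpos`. -/
theorem IsDonaldsonFlow.exists_hasDerivAt_relTrace_nonpos (hg : IsDonaldsonFlow Ω lam g)
    (hh : IsDonaldsonFlow Ω lam h) {t : ℝ} (ht : 0 < t) {x : X}
    (hmax : ∀ y, (g t).relTrace (h t) y ≤ (g t).relTrace (h t) x) :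
    ∃ d ≤ 0, HasDerivAt (fun s => (g s).relTrace (h s) x) d t := by
  set e := trivializationAt (Fin r → ℂ) E x
  have hx : x ∈ e.baseSet := FiberBundle.mem_baseSet_trivializationAt' (F := Fin r → ℂ) (E := E) x
  set φ := chartAt (CSpace n) x
  have hφx : φ.symm (φ x) = x := φ.left_inv (mem_chart_source _ x)
  have hzt : φ x ∈ φ.target := φ.map_source (mem_chart_source _ x)
  have hnear : ∀ᶠ w in nhds (φ x), φ.symm w ∈ e.baseSet := by
    refine (φ.continuousAt_symm hzt).eventually_mem ?_
    rw [hφx]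
    exact e.open_baseSet.mem_nhds hx
  have hlm : IsLocalMax (fun w => (((g t).mat φ e w)⁻¹ * (h t).mat φ e w).trace.re) (φ x) := by
    refine hnear.mono fun w hw => ?_
    simp only [HermitianMetric.mat_eq_gramAt, hφx]
    rw [← HermitianMetric.relTrace_eq _ _ e hw, ← HermitianMetric.relTrace_eq _ _ e hx]
    exact hmax _
  have smg : EntrySmoothAt ((g t).mat φ e) (φ x) := (g t).entrySmoothAt_mat e hx
  have smh : EntrySmoothAt ((h t).mat φ e) (φ x) := (h t).entrySmoothAt_mat e hx
  have hspace := re_trace_curvature_difference_nonpos smg smh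
    (hnear.mono fun w hw => (g t).gramAt_posDef e hw)
    (hnear.mono fun w hw => (h t).gramAt_posDef e hw) hlm (Ω.gram_posSemidef φ (φ x)).inv
  have sg := hg.entrySmoothAt_time e hx ht
  have sh := hh.entrySmoothAt_time e hx ht
  have ug : ∀ s, IsUnit ((g s).gramAt e x) := fun s => ((g s).gramAt_posDef e hx).isUnit
  have si := sg.inv (ug t)
  have fg := hg.flow e φ (chart_mem_atlas _ x) (φ x) hzt (by rwa [hφx]) t ht.le
  have fh := hh.flow e φ (chart_mem_atlas _ x) (φ x) hzt (by rwa [hφx]) t ht.le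
  rw [matDeriv_evalOne ht] at fg fh
  have hmg : ∀ s, (g s).mat φ e (φ x) = (g s).gramAt e x := fun s => by
    rw [HermitianMetric.mat_eq_gramAt, hφx]
  have hmh : ∀ s, (h s).mat φ e (φ x) = (h s).gramAt e x := fun s => by
    rw [HermitianMetric.mat_eq_gramAt, hφx]
  simp only [hmg, hmh] at fg fh hspace
  have hu : ∀ A : Matrix (Fin r) (Fin r) ℂ, IsUnit A → A * A⁻¹ = 1 := fun A hA =>
    Matrix.mul_nonsing_inv _ ((Matrix.isUnit_iff_isUnit_det _).1 hA)
  refine ⟨(evalOne (fderiv ℝ (fun s => (((g s).gramAt e x)⁻¹ * (h s).gramAt e x).trace) t)).re,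
    ?_, ?_⟩
  · rw [← trace_matDeriv (si.mul sh).entryDiffAt, matDeriv_mul si.entryDiffAt sh.entryDiffAt,
      matDeriv_inv sg.entryDiffAt si.entryDiffAt (Filter.Eventually.of_forall ug)]
    set G := (g t).gramAt e x
    set H := (h t).gramAt e x
    have hH : H * H⁻¹ = 1 := hu H ((h t).gramAt_posDef e hx).isUnit
    have e1 : (-(G⁻¹ * matDeriv evalOne (fun s => (g s).gramAt e x) t * G⁻¹) * H +
        G⁻¹ * matDeriv evalOne (fun s => (h s).gramAt e x) t).trace =
        (G⁻¹ * H * (H⁻¹ * matDeriv evalOne (fun s => (h s).gramAt e x) t -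
          G⁻¹ * matDeriv evalOne (fun s => (g s).gramAt e x) t)).trace := by
      rw [mul_sub, Matrix.trace_sub, Matrix.trace_add, neg_mul, Matrix.trace_neg,
        mul_assoc _ G⁻¹ H, Matrix.trace_mul_comm (G⁻¹ * matDeriv _ _ _),
        mul_assoc G⁻¹ H (H⁻¹ * _), ← mul_assoc H, hH, one_mul]
      ring
    rw [e1, fg, fh]
    -- The λ terms cancel. The factor is −2i · (−i) = −2, and the minus sign in the curvature
    -- coefficients makes it +2.
    have e2 : (-2 * Complex.I) • (lambdaOp (Ω.gram φ (φ x)) ((h t).curvature φ e (φ x)) -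
          lam • (1 : Matrix (Fin r) (Fin r) ℂ)) -
        (-2 * Complex.I) • (lambdaOp (Ω.gram φ (φ x)) ((g t).curvature φ e (φ x)) -
          lam • (1 : Matrix (Fin r) (Fin r) ℂ)) =
        (2 : ℂ) • ∑ j, ∑ k, (Ω.gram φ (φ x))⁻¹ k j •
          (matDZbar k (fun w => ((h t).mat φ e w)⁻¹ * matDZ j ((h t).mat φ e) w) (φ x) -
            matDZbar k (fun w => ((g t).mat φ e w)⁻¹ * matDZ j ((g t).mat φ e) w) (φ x)) := by
      simp only [lambdaOp, HermitianMetric.curvature, smul_sub, smul_neg, Finset.sum_neg_distrib,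
        Finset.sum_sub_distrib, smul_smul]
      have : -2 * Complex.I * -Complex.I = -2 := by linear_combination 2 * Complex.I_sq
      rw [this]
      simp only [neg_smul]
      abel
    rw [e2]
    simp only [Matrix.mul_smul, Matrix.mul_sum, Matrix.trace_smul, Matrix.trace_sum, smul_eq_mul]
    rw [show (2 : ℂ) = ((2 : ℝ) : ℂ) by norm_num, Complex.re_ofReal_mul]
    linarith
  · have hd : DifferentiableAt ℝ
        (fun s => (((g s).gramAt e x)⁻¹ * (h s).gramAt e x).trace) t := by
      simp only [Matrix.trace, Matrix.diag_apply]
      exact DifferentiableAt.fun_sum fun a _ => (si.mul sh).entryDiffAt a a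
    have h1 := Complex.reCLM.hasFDerivAt.comp_hasDerivAt t hd.hasDerivAt
    have h2 : (fun s => (g s).relTrace (h s) x) =
        fun s => (((g s).gramAt e x)⁻¹ * (h s).gramAt e x).trace.re :=
      funext fun s => HermitianMetric.relTrace_eq _ _ e hx
    rw [h2]
    exact h1

theorem IsDonaldsonFlow.exists_sq_le [CompactSpace X] (hg : IsDonaldsonFlow Ω lam g)
    (hh : IsDonaldsonFlow Ω lam h) :
    ∃ K : ℝ, ∀ t, 0 ≤ t → ∀ (x : X) (v : E x), (h t).sq x v ≤ K * (g t).sq x v := by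
  obtain ⟨K, hK⟩ := exists_bound_of_deriv_nonpos_at_max (hg.continuousOn_relTrace hh)
    fun t ht x hmax => hg.exists_hasDerivAt_relTrace_nonpos hh ht hmax
  exact ⟨K, fun t ht x v => ((h t).sq_le_relTrace_mul (g t) x v).trans
    (mul_le_mul_of_nonneg_right (hK t ht x) ((g t).sq_nonneg x v))⟩

end Flow

theorem mainTheorem4 {n r : ℕ} {X : Type*} [TopologicalSpace X] [T2Space X] [CompactSpace X]
    [ChartedSpace (CSpace n) X] [IsManifold 𝓘(ℂ, CSpace n) ω X]
    {E : X → Type*} [∀ x, AddCommGroup (E x)] [∀ x, Module ℂ (E x)]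
    [∀ x, TopologicalSpace (E x)] [TopologicalSpace (TotalSpace (Fin r → ℂ) E)]
    [FiberBundle (Fin r → ℂ) E] [VectorBundle ℂ (Fin r → ℂ) E]
    [ContMDiffVectorBundle ω (Fin r → ℂ) E 𝓘(ℂ, CSpace n)]
    (Ω : KaehlerForm n X) (lam : ℂ) (g h : ℝ → HermitianMetric n r E)
    (hg : IsDonaldsonFlow Ω lam g) (hh : IsDonaldsonFlow Ω lam h) :
    ∃ C : ℝ, 1 ≤ C ∧ ∀ t : ℝ, 0 ≤ t → ∀ (x : X) (v : E x),
      C⁻¹ * (g t).sq x v ≤ (h t).sq x v ∧ (h t).sq x v ≤ C * (g t).sq x v := by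
  obtain ⟨K, hK⟩ := hg.exists_sq_le hh
  obtain ⟨K', hK'⟩ := hh.exists_sq_le hg
  -- The lower bound is the upper bound with g and h exchanged; including 1 gives C ≥ 1 whatever the
  -- signs of `K` and `K'`.
  set C := max 1 (max K K')
  have hC : 0 < C := lt_max_of_lt_left one_pos
  refine ⟨C, le_max_left _ _, fun t ht x v => ⟨?_, ?_⟩⟩
  · rw [inv_mul_le_iff₀ hC]
    exact (hK' t ht x v).trans (mul_le_mul_of_nonneg_right
      ((le_max_right _ _).trans (le_max_right _ _)) ((h t).sq_nonneg x v))
  · exact (hK t ht x v).trans (mul_le_mul_of_nonneg_right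
      ((le_max_left _ _).trans (le_max_right _ _)) ((g t).sq_nonneg x v))
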